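/- Let $G$ be a finite undirected graph (parallel edges and loops allowed) with a designated set $\partial V$ of boundary vertices such that every connected component of $G$ contains at least one boundary vertex, and let each edge $e$ have a weight $\mathrm{wt}(e)$ in a commutative ring $R$. A *grove* is a spanning forest of $G$ each of whose component trees contains at least one boundary vertex; its weight $\mathrm{wt}(g)$ is the product of the weights of its edges, and it induces the partition of $\partial V$ in which two boundary vertices lie in the same part exactly when they lie in the same tree. Let $\mathrm{Tree}(\partial V)$ be the set of groves inducing the partition of $\partial V$ into singletons. For tuples $\mathbf a=(a_1,\dots,a_k)$ and $\mathbf b=(b_1,\dots,b_k)$ of boundary vertices that are disjoint ($a_i\neq b_j$ for all $i,j$), let $\mathrm{Grove}_k(\mathbf a,\mathbf b)$ be the set of groves inducing the partition with parts $\{a_i,b_i\}$ for $1\le i\le k$ and singletons for all other boundary vertices, where $\mathrm{Grove}_k(\mathbf a,\mathbf b)=\varnothing$ if $\mathbf a$ or $\mathbf b$ has a repeated entry. Assume that $$Z_{\partial V}=\sum_{g\in\mathrm{Tree}(\partial V)}\mathrm{wt}(g)$$ is invertible in $R$, and put $$G_k(\mathbf a,\mathbf b)=\frac1{Z_{\partial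 V}}\sum_{g\in\mathrm{Grove}_k(\mathbf a,\mathbf b)}\mathrm{wt}(g),\qquad \tilde G_k(\mathbf a,\mathbf b)=\sum_{\sigma\in S_k}\mathrm{sgn}(\sigma)\,G_k(\mathbf a,\mathbf b_\sigma),\qquad \mathbf b_\sigma=(b_{\sigma(1)},\dots,b_{\sigma(k)}).$$ Then for every $k\ge 0$ and all disjoint $k$-tuples $\mathbf a,\mathbf b$ of boundary vertices, $$\tilde G_k(\mathbf a,\mathbf b)=\det\bigl(\tilde G_1(a_i,b_j)\bigr)_{i,j=1}^k.$$ -/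

import Mathlib

open scoped Graph

namespace Grove

/-!
`G : Graph α β` is Mathlib's undirected multigraph (parallel edges and loops allowed), with vertex
set `V(G)` and edge set `E(G)`.  A designated set `bd : Set V(G)` of boundary vertices makes it a
graph-with-boundary; the interior vertices are those in `bdᶜ`.  Edge weights are given by
`wt : β → R`, of which only the values on `E(G)` are used.
-/

/-- The simple graph on `V(G)` underlying the spanning subgraph of `G` with edge set `S`.  It has the
same connected components as that spanning subgraph. -/
def spanning {α β : Type*} (G : Graph α β) (S : Finset β) : SimpleGraph V(G) where
  Adj u v := u ≠ v ∧ ∃ e ∈ S, G.IsLink e u v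
  symm := ⟨fun _ _ h => ⟨h.1.symm, h.2.imp fun _ he => ⟨he.1, he.2.symm⟩⟩⟩

/-- Every connected component of `G` contains at least one boundary vertex. -/
def ComponentsMeetBoundary {α β : Type*} (G : Graph α β) (bd : Set V(G)) : Prop :=
  ∀ v : V(G), ∃ x ∈ bd, G.toSimpleGraph.Reachable v x

/-- The set `S` of edges of `G` is the edge set of a spanning forest: the spanning subgraph with
edge set `S` has no cycle, i.e. no loops, no parallel edges, and no cycle of length at least `3`. -/
structure IsSpanningForest {α β : Type*} (G : Graph α β) (S : Finset β) : Prop where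
  subset : (S : Set β) ⊆ E(G)
  simple : (G.restrict (S : Set β)).Simple
  acyclic : (spanning G S).IsAcyclic

/-- A grove (given by its edge set) is a spanning forest each of whose component trees contains at
least one boundary vertex. -/
structure IsGrove {α β : Type*} (G : Graph α β) (bd : Set V(G)) (S : Finset β) : Prop where
  isSpanningForest : IsSpanningForest G S
  meets_boundary : ∀ v : V(G), ∃ x ∈ bd, (spanning G S).Reachable v x

/-- The (set of parts of the) partition of the boundary induced by `S`: two boundary vertices are
in the same part when they are in the same component of the spanning subgraph. -/
def inducedPartition {α β : Type*} (G : Graph α β) (bd : Set V(G)) (S : Finset β) :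
    Set (Set V(G)) :=
  {P | ∃ x ∈ bd, P = {y | y ∈ bd ∧ (spanning G S).Reachable x y}}

/-- The (set of parts of the) partition of `bd` with parts `{a i, b i}`, and singletons for all other
elements of `bd`. -/
def pairingPartition {X : Type*} (bd : Set X) {k : ℕ} (a b : Fin k → X) : Set (Set X) :=
  {P | ∃ i, P = {a i, b i}} ∪ {P | ∃ x ∈ bd, x ∉ Set.range a ∧ x ∉ Set.range b ∧ P = {x}}

/-- `Tree(∂V)`: the groves that induce the partition of the boundary into singletons. -/
def treeSet {α β : Type*} (G : Graph α β) (bd : Set V(G)) : Set (Finset β) :=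
  {S | IsGrove G bd S ∧ inducedPartition G bd S = {P | ∃ x ∈ bd, P = {x}}}

/-- `Grove_k(a, b)`: the groves that induce the partition with parts `{a i, b i}` and singletons for
all other boundary vertices; by convention empty if `a` or `b` has a repeated entry. -/
def groveSet {α β : Type*} (G : Graph α β) (bd : Set V(G)) {k : ℕ} (a b : Fin k → V(G)) :
    Set (Finset β) :=
  {S | Function.Injective a ∧ Function.Injective b ∧
    IsGrove G bd S ∧ inducedPartition G bd S = pairingPartition bd a b}

/-- The weight of a set of edges is the product of the weights of its edges. -/
def weight {β R : Type*} [CommRing R] (wt : β → R) (S : Finset β) : R :=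
  ∏ e ∈ S, wt e

/-- `Z_{∂V}`: the sum of the weights of the groves in `Tree(∂V)`. -/
noncomputable def Z {α β R : Type*} [CommRing R] (G : Graph α β) (bd : Set V(G)) (wt : β → R) : R :=
  ∑ᶠ S ∈ treeSet G bd, weight wt S

/-- `G_k(a, b)`: the sum of the weights of the groves in `Grove_k(a, b)`, divided by `Z_{∂V}`
(which is meant to be a unit). -/
noncomputable def groveSum {α β R : Type*} [CommRing R] (G : Graph α β) (bd : Set V(G)) (wt : β → R)
    {k : ℕ} (a b : Fin k → V(G)) : R :=
  Ring.inverse (Z G bd wt) * ∑ᶠ S ∈ groveSet G bd a b, weight wt S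

/-- `G̃_k(a, b) = ∑ σ, sgn(σ) G_k(a, b_σ)`, where `b_σ = (b_{σ(1)}, …, b_{σ(k)})`. -/
noncomputable def signedGroveSum {α β R : Type*} [CommRing R] (G : Graph α β) (bd : Set V(G))
    (wt : β → R) {k : ℕ} (a b : Fin k → V(G)) : R :=
  ∑ σ : Equiv.Perm (Fin k), ((Equiv.Perm.sign σ : ℤ) : R) * groveSum G bd wt a (b ∘ σ)

end Grove

/-!
Let `L = ∑ e, wt e • ∂e ∂eᵀ` be the weighted Laplacian, `∂e` being the incidence vector of `e`.  By
the Cauchy–Binet formula, the minor of `L` whose rows are the interior vertices and the `a i`, and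
whose columns are the interior vertices and the `b i`, is a sum over the edge sets that are forests
rooted both at `bd \ {a i}` and at `bd \ {b i}`.  These are the groves joining each `a i` to some
`b (σ i)`, and each occurs with the sign `(-1) ^ k * sgn σ`.  So the minor is
`(-1) ^ k * Z * G̃_k(a, b)`, and for `k = 0` it is `Z`.  Sylvester's determinant identity, with the
interior minor as pivot, expresses it through the minors with `k = 1`.
-/

namespace Grove

section Determinants

open Matrix

variable {m n p R : Type*} [Fintype m] [DecidableEq m] [CommRing R]

theorem det_sum_mul_eq_sum_piFinset (A : Matrix m n R) (B : Matrix n m R) (E : Finset n) :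
    det (of fun i j => ∑ e ∈ E, A i e * B e j) =
      ∑ f ∈ Fintype.piFinset fun _ : m => E, (∏ i, A i (f i)) * det (B.submatrix f id) := by
  have hrows : (of fun i j => ∑ e ∈ E, A i e * B e j) = fun i => ∑ e ∈ E, A i e • B e := by
    ext i j
    simp only [of_apply, Finset.sum_apply, Pi.smul_apply, smul_eq_mul]
  rw [hrows]
  exact (detRowAlternating.toMultilinearMap.map_sum_finset _ _).trans
    (Finset.sum_congr rfl fun f _ => detRowAlternating.toMultilinearMap.map_smul_univ _ _)

theorem sum_piFinset_eq_sum_powersetCard {M : Type*} [AddCommMonoid M] {F : (m → n) → M}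
    (hF : ∀ f, F f ≠ 0 → Function.Injective f) (E : Finset n) :
    ∑ f ∈ Fintype.piFinset fun _ => E, F f =
      ∑ S ∈ E.powersetCard (Fintype.card m), ∑ f ∈ Fintype.piFinset fun _ => S, F f := by
  classical
  have image_subset {f : m → n} {S : Finset n} (hf : f ∈ Fintype.piFinset fun _ => S) :
      Finset.univ.image f ⊆ S :=
    Finset.image_subset_iff.2 fun i _ => Fintype.mem_piFinset.1 hf i
  have card_image {f : m → n} (hf : Function.Injective f) :
      (Finset.univ.image f).card = Fintype.card m := Finset.card_image_of_injective _ hf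
  -- An injective `f` occurs in the inner sum of exactly one `S`, namely its image.
  rw [← Finset.sum_filter_of_ne fun f _ => hF f,
    ← Finset.sum_fiberwise_of_maps_to (t := E.powersetCard (Fintype.card m))
      (g := fun f => Finset.univ.image f)]
  · refine Finset.sum_congr rfl fun S hS => ?_
    obtain ⟨hSE, hcard⟩ := Finset.mem_powersetCard.1 hS
    refine Finset.sum_subset (fun f hf => ?_) fun f hfS hf => ?_
    · exact Fintype.mem_piFinset.2 fun i =>
        (Finset.mem_filter.1 hf).2 ▸ Finset.mem_image_of_mem f (Finset.mem_univ i)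
    · by_contra hne
      have himage : Finset.univ.image f = S :=
        Finset.eq_of_subset_of_card_le (image_subset hfS) (by rw [hcard, card_image (hF f hne)])
      have hfE := Fintype.piFinset_subset _ _ (fun _ => hSE) hfS
      exact hf (Finset.mem_filter.2 ⟨Finset.mem_filter.2 ⟨hfE, hF f hne⟩, himage⟩)
  · intro f hf
    obtain ⟨hfE, hinj⟩ := Finset.mem_filter.1 hf
    exact Finset.mem_powersetCard.2 ⟨image_subset hfE, card_image hinj⟩

/-- The **Cauchy–Binet formula**. -/
theorem det_sum_mul_eq_sum_powersetCard (A : Matrix m n R) (B : Matrix n m R) (E : Finset n) :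
    det (of fun i j => ∑ e ∈ E, A i e * B e j) =
      ∑ S ∈ E.powersetCard (Fintype.card m), det (of fun i j => ∑ e ∈ S, A i e * B e j) := by
  simp only [det_sum_mul_eq_sum_piFinset]
  refine sum_piFinset_eq_sum_powersetCard (fun f hf i j hij => ?_) E
  by_contra hne
  have hdet : det (B.submatrix f id) = 0 :=
    det_zero_of_row_eq hne (by ext l; simp only [submatrix_apply, hij])
  exact hf (by rw [hdet, mul_zero])

theorem det_sum_mul_eq_det_mul_det (A : Matrix m n R) (B : Matrix n m R) {S : Finset n}
    (col : m ≃ S) :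
    det (of fun i j => ∑ e ∈ S, A i e * B e j) =
      det (A.submatrix id (Subtype.val ∘ col)) * det (B.submatrix (Subtype.val ∘ col) id) := by
  rw [← det_mul]
  congr 1
  ext i j
  rw [of_apply, ← Finset.sum_coe_sort, ← col.sum_comp]
  rfl

theorem det_submatrix_eq_zero_of_not_injective {V : Type*} (L : Matrix V V R) {r c : m → V}
    (h : ¬(Function.Injective r ∧ Function.Injective c)) : (L.submatrix r c).det = 0 := by
  simp only [not_and_or, Function.not_injective_iff] at h
  obtain ⟨i, j, hij, hne⟩ | ⟨i, j, hij, hne⟩ := h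
  · exact det_zero_of_row_eq hne (by ext l; simp only [submatrix_apply, hij])
  · exact det_zero_of_column_eq hne fun l => by simp only [submatrix_apply, hij]

theorem det_fromRows_neg_add_mul [Fintype p] [DecidableEq p] (X : Matrix m (m ⊕ p) R)
    (A : Matrix p (m ⊕ p) R) (C : Matrix p m R) :
    det (fromRows X (-A + C * X)) = (-1) ^ Fintype.card p * det (fromRows X A) := by
  have hmul : fromRows X (-A + C * X) = fromBlocks 1 0 C (-1) * fromRows X A := by
    rw [fromBlocks_mul_fromRows, Matrix.one_mul, Matrix.zero_mul, add_zero, Matrix.neg_mul,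
      Matrix.one_mul, add_comm]
  rw [hmul, det_mul, det_fromBlocks_zero₁₂, det_one, one_mul, det_neg, det_one, mul_one]

theorem det_submatrix_sumElim_eq_mul_det_schur {V : Type*} [Fintype p] [DecidableEq p]
    (L : Matrix V V R) (f : m → V) [Invertible (L.submatrix f f)] (a b : p → V) :
    (L.submatrix (Sum.elim f a) (Sum.elim f b)).det = (L.submatrix f f).det *
      (L.submatrix a b - L.submatrix a f * ⅟(L.submatrix f f) * L.submatrix f b).det := by
  rw [← det_fromBlocks₁₁]
  congr 1
  ext (i | i) (j | j) <;> rfl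

/-- **Sylvester's determinant identity**. -/
theorem det_submatrix_sumElim {V : Type*} [Fintype p] [DecidableEq p] (L : Matrix V V R)
    (f : m → V) (hf : IsUnit (L.submatrix f f).det) (a b : p → V) :
    (L.submatrix (Sum.elim f a) (Sum.elim f b)).det =
      (L.submatrix f f).det * det (of fun i j => Ring.inverse (L.submatrix f f).det *
        (L.submatrix (Sum.elim f ![a i]) (Sum.elim f ![b j])).det) := by
  let _ := invertibleOfIsUnitDet _ hf
  rw [det_submatrix_sumElim_eq_mul_det_schur]
  congr 2
  ext i j
  rw [of_apply, det_submatrix_sumElim_eq_mul_det_schur, ← mul_assoc,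
    Ring.inverse_mul_cancel _ hf, one_mul, det_fin_one]
  rfl

end Determinants

section Forests

variable {α β : Type*} {G : Graph α β} {S S' : Finset β} {e : β} {u v x y : V(G)} {T : Set V(G)}

theorem spanning_mono (h : S ⊆ S') : spanning G S ≤ spanning G S' :=
  fun _ _ huv => ⟨huv.1, huv.2.imp fun _ he => ⟨h he.1, he.2⟩⟩

theorem reachable_of_isLink (he : e ∈ S) (h : G.IsLink e u v) : (spanning G S).Reachable u v := by
  by_cases huv : u = v
  · rw [huv]
  · exact SimpleGraph.Adj.reachable ⟨huv, e, he, h⟩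

theorem exists_isLink (he : e ∈ E(G)) : ∃ u v : V(G), G.IsLink e u v := by
  obtain ⟨u, v, h⟩ := Graph.exists_isLink_of_mem_edgeSet he
  exact ⟨⟨u, h.left_mem⟩, ⟨v, h.right_mem⟩, h⟩

theorem isLink_sym2_eq {w z : V(G)} (h : G.IsLink e u v) (h' : G.IsLink e w z) :
    s(u, v) = s(w, z) := by
  rw [Sym2.eq_iff]
  exact (h.eq_and_eq_or_eq_and_eq h').imp (.imp Subtype.ext Subtype.ext)
    (.imp Subtype.ext Subtype.ext)

theorem reachable_erase [DecidableEq β] (hl : G.IsLink e u v)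
    (huv : (spanning G (S.erase e)).Reachable u v) (hxy : (spanning G S).Reachable x y) :
    (spanning G (S.erase e)).Reachable x y := by
  obtain ⟨p⟩ := hxy
  induction p with
  | nil => rfl
  | cons hadj _ ih =>
    obtain ⟨-, f, hf, hlf⟩ := hadj
    refine SimpleGraph.Reachable.trans ?_ ih
    by_cases hfe : f = e
    · subst hfe
      obtain ⟨rfl, rfl⟩ | ⟨rfl, rfl⟩ := Sym2.eq_iff.1 (isLink_sym2_eq hlf hl)
      exacts [huv, huv.symm]
    · exact reachable_of_isLink (Finset.mem_erase.2 ⟨hfe, hf⟩) hlf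

theorem IsSpanningForest.not_reachable_erase [DecidableEq β] (hS : IsSpanningForest G S)
    (he : e ∈ S) (hl : G.IsLink e u v) : ¬(spanning G (S.erase e)).Reachable u v := by
  intro hr
  have hne : u ≠ v := by
    rintro rfl
    exact hS.simple.not_isLoopAt e u (Graph.restrict_isLoopAt.2 ⟨hl, he⟩)
  have hbridge := SimpleGraph.isAcyclic_iff_forall_adj_isBridge.1 hS.acyclic
    (show (spanning G S).Adj u v from ⟨hne, e, he, hl⟩)
  refine SimpleGraph.isBridge_iff.1 hbridge (hr.mono ?_)
  rintro x y ⟨hxy, f, hf, hlf⟩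
  obtain ⟨hfe, hfS⟩ := Finset.mem_erase.1 hf
  refine SimpleGraph.deleteEdges_adj.2 ⟨⟨hxy, f, hfS, hlf⟩, fun hxy_eq => hfe ?_⟩
  have hlf' : G.IsLink f u v := by
    obtain ⟨rfl, rfl⟩ | ⟨rfl, rfl⟩ := Sym2.eq_iff.1 hxy_eq
    exacts [hlf, hlf.symm]
  exact hS.simple.eq_of_isLink (x := u) (y := v)
    (by simpa only [Graph.restrict_isLink] using ⟨hfS, hlf'⟩)
    (by simpa only [Graph.restrict_isLink] using ⟨he, hl⟩)

theorem isSpanningForest_of_not_reachable_erase [DecidableEq β] (hS : (S : Set β) ⊆ E(G))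
    (hbridge : ∀ e ∈ S, ∀ u v : V(G), G.IsLink e u v →
      ¬(spanning G (S.erase e)).Reachable u v) : IsSpanningForest G S where
  subset := hS
  simple :=
    { not_isLoopAt e x hx := by
        obtain ⟨hl, he⟩ := Graph.restrict_isLoopAt.1 hx
        exact hbridge e he ⟨x, hl.left_mem⟩ ⟨x, hl.left_mem⟩ hl .rfl
      eq_of_isLink e f x y he hf := by
        rw [Graph.restrict_isLink] at he hf
        obtain ⟨⟨heS, hle⟩, hfS, hlf⟩ := And.intro he hf
        by_contra hne
        exact hbridge e heS ⟨x, hle.left_mem⟩ ⟨y, hle.right_mem⟩ hle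
          (reachable_of_isLink (Finset.mem_erase.2 ⟨Ne.symm hne, hfS⟩) hlf) }
  acyclic := by
    refine SimpleGraph.isAcyclic_iff_forall_adj_isBridge.2 fun u v ⟨_, e, he, hl⟩ => ?_
    refine SimpleGraph.isBridge_iff.2 fun hr => hbridge e he u v hl (hr.mono fun x y hxy => ?_)
    obtain ⟨⟨hne, f, hf, hlf⟩, hxy_ne⟩ := SimpleGraph.deleteEdges_adj.1 hxy
    refine ⟨hne, f, Finset.mem_erase.2 ⟨?_, hf⟩, hlf⟩
    rintro rfl
    exact hxy_ne (isLink_sym2_eq hlf hl)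

/-- The edge set `S` is that of a spanning forest of `G` rooted at `T`: each of its component trees
contains exactly one vertex of `T`. -/
structure IsRootedForest (G : Graph α β) (S : Finset β) (T : Set V(G)) : Prop
    extends IsSpanningForest G S where
  exists_root : ∀ v, ∃ x ∈ T, (spanning G S).Reachable v x
  root_unique : ∀ x ∈ T, ∀ y ∈ T, (spanning G S).Reachable x y → x = y

theorem IsRootedForest.exists_isLink_not_reachable_erase [DecidableEq β]
    (hS : IsRootedForest G S T) (he : e ∈ S) :
    ∃ u v : V(G), G.IsLink e u v ∧ ¬(spanning G (S.erase e)).Reachable u v ∧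
      ∀ x ∈ T, ¬(spanning G (S.erase e)).Reachable u x := by
  obtain ⟨u, v, hl⟩ := exists_isLink (hS.subset he)
  have huv := hS.not_reachable_erase he hl
  by_contra! hcon
  obtain ⟨x, hx, hux⟩ := hcon u v hl huv
  obtain ⟨y, hy, hvy⟩ := hcon v u hl.symm fun h => huv h.symm
  have hmono := spanning_mono (G := G) (Finset.erase_subset e S)
  have hxy : x = y := hS.root_unique x hx y hy
    ((hux.mono hmono).symm.trans ((reachable_of_isLink he hl).trans (hvy.mono hmono)))
  exact huv (hux.trans (hxy ▸ hvy.symm))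

end Forests

section Incidence

open Matrix

variable {α β m n : Type*} {G : Graph α β} {S : Finset β} {T : Set V(G)}

open Classical in
/-- The column of the incidence matrix of `G` that belongs to the edge `e`, for an arbitrary
orientation of `e`; it vanishes if `e` is a loop or not an edge. -/
noncomputable def incidence (G : Graph α β) (e : β) : V(G) → ℤ :=
  if h : ∃ p : V(G) × V(G), G.IsLink e p.1 p.2 then
    Pi.single h.choose.1 1 - Pi.single h.choose.2 1
  else 0

theorem incidence_eq_or [DecidableEq V(G)] {e : β} {u v : V(G)} (h : G.IsLink e u v) :
    incidence G e = Pi.single u 1 - Pi.single v 1 ∨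
      incidence G e = -(Pi.single u 1 - Pi.single v 1) := by
  have hex : ∃ p : V(G) × V(G), G.IsLink e p.1 p.2 := ⟨(u, v), h⟩
  rw [incidence, dif_pos hex]
  obtain ⟨hu, hv⟩ | ⟨hu, hv⟩ := Sym2.eq_iff.1 (isLink_sym2_eq hex.choose_spec h)
  · left
    rw [hu, hv]
    congr!
  · right
    rw [hu, hv, neg_sub]
    congr!

/-- The incidence matrix of `G` with rows at the vertices `row i` and columns at the edges
`col j`. -/
noncomputable def incMatrix (G : Graph α β) (row : m → V(G)) (col : n → β) : Matrix m n ℤ :=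
  of fun i j => incidence G (col j) (row i)

variable {row : m → V(G)} {col : n → β}

theorem indicator_vecMul_incMatrix [Fintype m] (hrow : Function.Injective row) {s : Set V(G)}
    (hs : s ⊆ Set.range row) {j : n} {u v : V(G)} (hl : G.IsLink (col j) u v) :
    ((s.indicator 1 ∘ row) ᵥ* incMatrix G row col) j = s.indicator 1 u - s.indicator 1 v ∨
      ((s.indicator 1 ∘ row) ᵥ* incMatrix G row col) j =
        -(s.indicator 1 u - s.indicator 1 v) := by
  classical
  have hsingle (w : V(G)) : ∑ i, (s.indicator 1 (row i) : ℤ) * (Pi.single w 1 : V(G) → ℤ) (row i) =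
      s.indicator 1 w := by
    by_cases hw : w ∈ Set.range row
    · obtain ⟨i, rfl⟩ := hw
      simp [Pi.single_apply, hrow.eq_iff]
    · have hne (i : m) : row i ≠ w := fun h => hw ⟨i, h⟩
      simp [hne, Set.indicator_of_notMem fun h => hw (hs h)]
  simp only [vecMul, dotProduct, Function.comp_apply, incMatrix, of_apply]
  refine (incidence_eq_or hl).imp (fun h => ?_) fun h => ?_ <;>
    simp only [h, Pi.neg_apply, Pi.sub_apply, mul_neg, mul_sub, Finset.sum_neg_distrib,
      Finset.sum_sub_distrib, hsingle]

theorem indicator_vecMul_incMatrix_eq_zero [Fintype m] (hrow : Function.Injective row)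
    {s : Set V(G)} (hs : s ⊆ Set.range row) {j : n}
    (hclosed : ∀ u v : V(G), G.IsLink (col j) u v → (u ∈ s ↔ v ∈ s)) :
    ((s.indicator 1 ∘ row) ᵥ* incMatrix G row col) j = 0 := by
  classical
  by_cases hex : ∃ p : V(G) × V(G), G.IsLink (col j) p.1 p.2
  · obtain ⟨⟨u, v⟩, hl⟩ := hex
    have huv : (s.indicator 1 u : ℤ) = s.indicator 1 v := by
      simp only [Set.indicator_apply, hclosed u v hl, Pi.one_apply]
    simpa only [huv, sub_self, neg_zero, or_self] using indicator_vecMul_incMatrix hrow hs hl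
  · simp only [vecMul, dotProduct, incMatrix, of_apply, incidence, dif_neg hex, Pi.zero_apply,
      mul_zero, Finset.sum_const_zero]

theorem incMatrix_mulVec_surjective [Finite m] [Fintype n] (hrow : Function.Injective row)
    (hcol : (S : Set β) ⊆ Set.range col)
    (hroot : ∀ v, ∃ x ∈ (Set.range row)ᶜ, (spanning G S).Reachable v x) :
    Function.Surjective (incMatrix G row col).mulVec := by
  classical
  have := Fintype.ofFinite m
  set M := LinearMap.range (incMatrix G row col).mulVecLin
  let δ (v : V(G)) (i : m) : ℤ := (Pi.single v 1 : V(G) → ℤ) (row i)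
  have hadj {u v : V(G)} (huv : (spanning G S).Adj u v) : δ u - δ v ∈ M := by
    obtain ⟨_, e, he, hl⟩ := huv
    obtain ⟨j, rfl⟩ := hcol he
    have hj : incidence G (col j) ∘ row ∈ M :=
      ⟨Pi.single j 1, by rw [mulVecLin_apply, mulVec_single_one]; rfl⟩
    obtain h | h := incidence_eq_or hl
    · rwa [h] at hj
    · rw [h, Pi.neg_comp, neg_mem_iff] at hj
      exact hj
  have hreach {u v : V(G)} : (spanning G S).Reachable u v → δ u - δ v ∈ M := by
    rintro ⟨p⟩
    induction p with
    | nil => simp only [sub_self, zero_mem]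
    | cons h _ ih => simpa only [sub_add_sub_cancel] using add_mem (hadj h) ih
  have hsingle (i : m) : Pi.single i 1 ∈ M := by
    obtain ⟨x, hx, hr⟩ := hroot (row i)
    convert hreach hr using 1
    ext j
    have hjx : row j ≠ x := fun h => hx ⟨j, h⟩
    simp [δ, Pi.single_apply, hrow.eq_iff, hjx]
  have hM : M = ⊤ := by
    rw [eq_top_iff, ← (Pi.basisFun ℤ m).span_eq, Submodule.span_le]
    rintro _ ⟨i, rfl⟩
    simpa only [Pi.basisFun_apply, SetLike.mem_coe] using hsingle i
  exact LinearMap.range_eq_top.1 hM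

theorem card_le_card_of_exists_root [Fintype m] (hrow : Function.Injective row)
    (hroot : ∀ v, ∃ x ∈ (Set.range row)ᶜ, (spanning G S).Reachable v x) :
    Fintype.card m ≤ S.card := by
  rw [← Fintype.card_coe S]
  exact card_le_of_surjective ℤ (incMatrix G row (Subtype.val : S → β)).mulVecLin
    (incMatrix_mulVec_surjective hrow Subtype.range_coe.ge hroot)

theorem IsRootedForest.exists_vecMul_eq_single [DecidableEq S] [Fintype m]
    (hrow : Function.Injective row) (hS : IsRootedForest G S (Set.range row)ᶜ) (e : S) :
    ∃ c, c ᵥ* incMatrix G row (Subtype.val : S → β) = Pi.single e 1 := by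
  classical
  obtain ⟨u, v, hl, huv, hroot⟩ := hS.exists_isLink_not_reachable_erase e.2
  -- Removing `e` cuts off a part `s` without a root; `e` is the only edge of `S` that leaves `s`.
  let s : Set V(G) := {x | (spanning G (S.erase e)).Reachable u x}
  have hs : s ⊆ Set.range row := fun x hx => not_not.1 fun hxT => hroot x hxT hx
  have hu : (s.indicator 1 u : ℤ) = 1 :=
    Set.indicator_of_mem (show u ∈ s from SimpleGraph.Reachable.refl u) _
  have hv : (s.indicator 1 v : ℤ) = 0 := Set.indicator_of_notMem (show v ∉ s from huv) _
  set c := (s.indicator 1 ∘ row) ᵥ* incMatrix G row (Subtype.val : S → β)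
  have hoff (f : S) (hfe : f ≠ e) : c f = 0 := by
    refine indicator_vecMul_incMatrix_eq_zero hrow hs fun w z hlf => ?_
    have hwz : (spanning G (S.erase e)).Reachable w z :=
      reachable_of_isLink (Finset.mem_erase.2 ⟨Subtype.coe_ne_coe.2 hfe, f.2⟩) hlf
    exact ⟨fun h => h.trans hwz, fun h => h.trans hwz.symm⟩
  have hc : c = Pi.single e (c e) := by
    ext f
    obtain rfl | hfe := eq_or_ne f e
    · rw [Pi.single_eq_same]
    · rw [Pi.single_eq_of_ne hfe, hoff f hfe]
  obtain h | h := indicator_vecMul_incMatrix hrow hs (col := (Subtype.val : S → β)) hl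
  · refine ⟨s.indicator 1 ∘ row, hc.trans ?_⟩
    rw [show c e = 1 from h.trans (by rw [hu, hv, sub_zero])]
  · refine ⟨-(s.indicator 1 ∘ row), (neg_vecMul ..).trans (congrArg _ hc) |>.trans ?_⟩
    rw [show c e = -1 from h.trans (by rw [hu, hv, sub_zero]), Pi.single_neg, neg_neg]

theorem IsRootedForest.card_eq [Fintype m] (hrow : Function.Injective row)
    (hS : IsRootedForest G S (Set.range row)ᶜ) : S.card = Fintype.card m := by
  classical
  refine le_antisymm ?_ (card_le_card_of_exists_root hrow hS.exists_root)
  choose c hc using hS.exists_vecMul_eq_single hrow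
  have hleft : of c * incMatrix G row (Subtype.val : S → β) = 1 := by
    ext e f
    exact (congrFun (hc e) f).trans one_eq_pi_single.symm
  rw [← Fintype.card_coe S]
  exact card_le_of_surjective ℤ (incMatrix G row (Subtype.val : S → β)).vecMulLinear
    (vecMul_surjective_iff_exists_left_inverse.2 ⟨_, hleft⟩)

theorem isRootedForest_of_card_eq [Fintype m] (hrow : Function.Injective row)
    (hS : (S : Set β) ⊆ E(G))
    (hroot : ∀ v, ∃ x ∈ (Set.range row)ᶜ, (spanning G S).Reachable v x)
    (hcard : S.card = Fintype.card m) : IsRootedForest G S (Set.range row)ᶜ where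
  toIsSpanningForest := by
    classical
    refine isSpanningForest_of_not_reachable_erase hS fun e he u v hl huv => ?_
    have hle : Fintype.card m ≤ (S.erase e).card :=
      card_le_card_of_exists_root hrow fun w =>
        (hroot w).imp fun x hx => ⟨hx.1, reachable_erase hl huv hx.2⟩
    exact hle.not_gt (hcard ▸ Finset.card_erase_lt_of_mem he)
  exists_root := hroot
  root_unique x hx y hy hxy := by
    by_contra hne
    have hrow' : Function.Injective (Sum.elim row fun _ : Unit => y) :=
      hrow.sumElim (Function.injective_of_subsingleton _) fun i _ h => hy ⟨i, h⟩
    have hle : Fintype.card (m ⊕ Unit) ≤ S.card :=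
      card_le_card_of_exists_root hrow' fun w => by
        obtain ⟨z, hz, hwz⟩ := hroot w
        simp only [Set.Sum.elim_range, Set.range_const, Set.compl_union]
        obtain rfl | hzy := eq_or_ne z y
        · exact ⟨x, ⟨hx, hne⟩, hwz.trans hxy.symm⟩
        · exact ⟨z, ⟨hz, hzy⟩, hwz⟩
    rw [hcard, Fintype.card_sum, Fintype.card_unit] at hle
    omega

theorem det_incMatrix_mul_self [Fintype m] [DecidableEq m] (hrow : Function.Injective row)
    (hS : IsRootedForest G S (Set.range row)ᶜ) (col : m ≃ S) :
    (incMatrix G row (Subtype.val ∘ col)).det * (incMatrix G row (Subtype.val ∘ col)).det = 1 := by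
  have hcol : (S : Set β) ⊆ Set.range (Subtype.val ∘ col) := by
    rw [col.surjective.range_comp, Subtype.range_coe]
  obtain ⟨B, hB⟩ := mulVec_surjective_iff_exists_right_inverse.1
    (incMatrix_mulVec_surjective hrow hcol hS.exists_root)
  refine Int.isUnit_mul_self (IsUnit.of_mul_eq_one B.det ?_)
  rw [← det_mul, hB, det_one]

theorem det_incMatrix_eq_zero [Fintype m] [DecidableEq m] (hrow : Function.Injective row)
    (hS : (S : Set β) ⊆ E(G)) (hforest : ¬IsRootedForest G S (Set.range row)ᶜ) (col : m ≃ S) :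
    (incMatrix G row (Subtype.val ∘ col)).det = 0 := by
  have hcard : S.card = Fintype.card m := by rw [Fintype.card_congr col, Fintype.card_coe]
  obtain ⟨w, hw⟩ : ∃ w, ∀ x ∈ (Set.range row)ᶜ, ¬(spanning G S).Reachable w x := by
    by_contra! hroot
    exact hforest (isRootedForest_of_card_eq hrow hS hroot hcard)
  -- The rows in the rootless component of `w` sum to zero.
  let s : Set V(G) := {x | (spanning G S).Reachable w x}
  have hs : s ⊆ Set.range row := fun x hx => not_not.1 fun hxT => hw x hxT hx
  have hws : w ∈ s := SimpleGraph.Reachable.refl w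
  refine exists_vecMul_eq_zero_iff.1 ⟨s.indicator 1 ∘ row, fun h => ?_, ?_⟩
  · obtain ⟨i, hi⟩ := hs hws
    have hone : (s.indicator 1 (row i) : ℤ) = 1 := Set.indicator_of_mem (hi ▸ hws) _
    exact one_ne_zero (hone.symm.trans (congrFun h i))
  · ext j
    refine indicator_vecMul_incMatrix_eq_zero hrow hs fun u v hl => ?_
    have huv : (spanning G S).Reachable u v := reachable_of_isLink (col j).2 hl
    exact ⟨fun h => h.trans huv, fun h => h.trans huv.symm⟩

theorem incidence_eq_neg_add_sum_incidence [Fintype m] (hrow : Function.Injective row)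
    {x y : V(G)} (hx : x ∉ Set.range row) (hy : y ∉ Set.range row) (hne : x ≠ y)
    (hxy : (spanning G S).Reachable x y)
    (hcomp : ∀ v, (spanning G S).Reachable x v → v ∈ Set.range row ∨ v = x ∨ v = y)
    {e : β} (he : e ∈ S) :
    incidence G e y = -incidence G e x +
      ∑ i, -({v | (spanning G S).Reachable x v}.indicator 1 (row i)) * incidence G e (row i) := by
  set s := {v | (spanning G S).Reachable x v}
  have hinj : Function.Injective (Sum.elim row ![x, y]) := by
    refine hrow.sumElim (fun i j => ?_) fun i j => ?_
    · fin_cases i <;> fin_cases j <;> simp [hne, hne.symm]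
    · fin_cases j
      exacts [fun h => hx ⟨i, h⟩, fun h => hy ⟨i, h⟩]
  have hs : s ⊆ Set.range (Sum.elim row ![x, y]) := fun v hv => by
    obtain ⟨i, rfl⟩ | rfl | rfl := hcomp v hv
    exacts [⟨.inl i, rfl⟩, ⟨.inr 0, rfl⟩, ⟨.inr 1, rfl⟩]
  -- No edge leaves the component of `x`, which lies in the rows together with `x` and `y`.
  have hsum := indicator_vecMul_incMatrix_eq_zero (col := fun _ : Unit => e) (j := ()) hinj hs
    fun u v hl => by
      have huv : (spanning G S).Reachable u v := reachable_of_isLink he hl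
      exact ⟨fun h => h.trans huv, fun h => h.trans huv.symm⟩
  have hxs : (s.indicator 1 x : ℤ) = 1 :=
    Set.indicator_of_mem (show x ∈ s from SimpleGraph.Reachable.refl x) _
  have hys : (s.indicator 1 y : ℤ) = 1 := Set.indicator_of_mem (show y ∈ s from hxy) _
  simp only [vecMul, dotProduct, incMatrix, of_apply, Function.comp_apply, Fintype.sum_sum_type,
    Sum.elim_inl, Sum.elim_inr, Fin.sum_univ_two, cons_val_zero, cons_val_one, hxs, hys,
    one_mul] at hsum
  simp only [neg_mul, Finset.sum_neg_distrib]
  linarith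

theorem det_incMatrix_sumElim_eq {p : Type*} [Fintype m] [DecidableEq m] [Fintype p]
    [DecidableEq p] (hrow : Function.Injective row) {a b : p → V(G)}
    (ha : ∀ i, a i ∉ Set.range row) (hb : ∀ i, b i ∉ Set.range row) (hab : ∀ i, a i ≠ b i)
    (hpath : ∀ i, (spanning G S).Reachable (a i) (b i))
    (hcomp : ∀ i v, (spanning G S).Reachable (a i) v → v ∈ Set.range row ∨ v = a i ∨ v = b i)
    {col : m ⊕ p → β} (hcol : ∀ j, col j ∈ S) :
    (incMatrix G (Sum.elim row b) col).det =
      (-1) ^ Fintype.card p * (incMatrix G (Sum.elim row a) col).det := by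
  have helim (c : p → V(G)) : incMatrix G (Sum.elim row c) col =
      fromRows (incMatrix G row col) (incMatrix G c col) := by
    ext (i | i) j <;> rfl
  let C : Matrix p m ℤ := of fun i j =>
    -({v | (spanning G S).Reachable (a i) v}.indicator 1 (row j))
  have hb_eq : incMatrix G b col = -incMatrix G a col + C * incMatrix G row col := by
    ext i j
    exact incidence_eq_neg_add_sum_incidence hrow (ha i) (hb i) (hab i) (hpath i) (hcomp i) (hcol j)
  rw [helim, helim, hb_eq, det_fromRows_neg_add_mul]

end Incidence

section Groves

open Matrix

variable {α β : Type*} {G : Graph α β} {bd : Set V(G)} {S : Finset β} {k : ℕ}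
  {a b : Fin k → V(G)}

theorem groveSet_comm (G : Graph α β) (bd : Set V(G)) (a b : Fin k → V(G)) :
    groveSet G bd a b = groveSet G bd b a := by
  have hpairing : pairingPartition bd a b = pairingPartition bd b a := by
    simp only [pairingPartition, Set.pair_comm, and_left_comm]
  ext S
  simp only [groveSet, hpairing, Set.mem_ofPred_eq, and_left_comm]

theorem treeSet_eq_groveSet (a b : Fin 0 → V(G)) : treeSet G bd = groveSet G bd a b := by
  ext S
  simp [treeSet, groveSet, pairingPartition, Function.injective_of_subsingleton]

theorem reachable_of_mem_groveSet (hS : S ∈ groveSet G bd a b) (i : Fin k) :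
    (spanning G S).Reachable (a i) (b i) := by
  obtain ⟨-, -, -, hpart⟩ := hS
  obtain ⟨x, -, hx⟩ : ({a i, b i} : Set V(G)) ∈ inducedPartition G bd S :=
    hpart ▸ Or.inl ⟨i, rfl⟩
  have ha : a i ∈ {y | y ∈ bd ∧ (spanning G S).Reachable x y} := hx ▸ Set.mem_insert _ _
  have hb : b i ∈ {y | y ∈ bd ∧ (spanning G S).Reachable x y} :=
    hx ▸ Set.mem_insert_of_mem _ rfl
  exact ha.2.symm.trans hb.2

theorem isRootedForest_of_mem_groveSet (hb : ∀ i, b i ∈ bd \ Set.range a)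
    (hS : S ∈ groveSet G bd a b) : IsRootedForest G S (bd \ Set.range a) where
  toIsSpanningForest := hS.2.2.1.isSpanningForest
  exists_root v := by
    obtain ⟨x, hx, hvx⟩ := hS.2.2.1.meets_boundary v
    by_cases hxa : x ∈ Set.range a
    · obtain ⟨i, rfl⟩ := hxa
      exact ⟨b i, hb i, hvx.trans (reachable_of_mem_groveSet hS i)⟩
    · exact ⟨x, ⟨hx, hxa⟩, hvx⟩
  root_unique x hx y hy hxy := by
    set P := {z | z ∈ bd ∧ (spanning G S).Reachable x z}
    have hxP : x ∈ P := ⟨hx.1, .rfl⟩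
    have hyP : y ∈ P := ⟨hy.1, hxy⟩
    have hP : P ∈ pairingPartition bd a b := hS.2.2.2 ▸ ⟨x, hx.1, rfl⟩
    obtain ⟨i, hi⟩ | ⟨z, -, -, -, hz⟩ := hP
    · have eq_b {w : V(G)} (hw : w ∈ bd \ Set.range a) (hwP : w ∈ P) : w = b i :=
        (hi ▸ hwP : w ∈ ({a i, b i} : Set V(G))).resolve_left fun h => hw.2 ⟨i, h.symm⟩
      rw [eq_b hx hxP, eq_b hy hyP]
    · have eq_z {w : V(G)} (hwP : w ∈ P) : w = z := (hz ▸ hwP : w ∈ ({z} : Set V(G)))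
      rw [eq_z hxP, eq_z hyP]

theorem eq_or_eq_of_reachable (ha : ∀ i, a i ∈ bd \ Set.range b)
    (hb : ∀ i, b i ∈ bd \ Set.range a)
    (hSa : IsRootedForest G S (bd \ Set.range a)) (hSb : IsRootedForest G S (bd \ Set.range b))
    {i : Fin k} (hpath : (spanning G S).Reachable (a i) (b i)) {v : V(G)} (hv : v ∈ bd)
    (hav : (spanning G S).Reachable (a i) v) : v = a i ∨ v = b i := by
  by_cases hva : v ∈ Set.range a
  · obtain ⟨j, rfl⟩ := hva
    exact .inl (hSb.root_unique _ (ha j) _ (ha i) hav.symm)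
  · exact .inr (hSa.root_unique _ ⟨hv, hva⟩ _ (hb i) (hav.symm.trans hpath))

theorem eq_of_reachable (ha : ∀ i, a i ∈ bd \ Set.range b)
    (hSa : IsRootedForest G S (bd \ Set.range a)) (hSb : IsRootedForest G S (bd \ Set.range b))
    {x y : V(G)} (hx : x ∈ bd)
    (hxa : x ∉ Set.range a) (hxb : x ∉ Set.range b) (hy : y ∈ bd)
    (hxy : (spanning G S).Reachable x y) : y = x := by
  by_cases hya : y ∈ Set.range a
  · obtain ⟨j, rfl⟩ := hya
    exact hSb.root_unique _ (ha j) _ ⟨hx, hxb⟩ hxy.symm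
  · exact hSa.root_unique _ ⟨hy, hya⟩ _ ⟨hx, hxa⟩ hxy.symm

theorem mem_groveSet_of_isRootedForest (hai : Function.Injective a) (hbi : Function.Injective b)
    (ha : ∀ i, a i ∈ bd \ Set.range b) (hb : ∀ i, b i ∈ bd \ Set.range a)
    (hSa : IsRootedForest G S (bd \ Set.range a)) (hSb : IsRootedForest G S (bd \ Set.range b))
    (hpath : ∀ i, (spanning G S).Reachable (a i) (b i)) : S ∈ groveSet G bd a b := by
  have hpair (i : Fin k) : {y | y ∈ bd ∧ (spanning G S).Reachable (a i) y} = {a i, b i} := by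
    ext y
    refine ⟨fun hy => eq_or_eq_of_reachable ha hb hSa hSb (hpath i) hy.1 hy.2, ?_⟩
    rintro (rfl | rfl)
    exacts [⟨(ha i).1, .rfl⟩, ⟨(hb i).1, hpath i⟩]
  have hsingle {x : V(G)} (hx : x ∈ bd) (hxa : x ∉ Set.range a) (hxb : x ∉ Set.range b) :
      {y | y ∈ bd ∧ (spanning G S).Reachable x y} = {x} := by
    ext y
    refine ⟨fun hy => eq_of_reachable ha hSa hSb hx hxa hxb hy.1 hy.2, ?_⟩
    rintro rfl
    exact ⟨hx, .rfl⟩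
  refine ⟨hai, hbi, ⟨hSa.toIsSpanningForest, fun v => ?_⟩, Set.Subset.antisymm ?_ ?_⟩
  · obtain ⟨x, hx, hvx⟩ := hSa.exists_root v
    exact ⟨x, hx.1, hvx⟩
  · rintro _ ⟨x, hx, rfl⟩
    by_cases hxa : x ∈ Set.range a
    · obtain ⟨i, rfl⟩ := hxa
      exact .inl ⟨i, hpair i⟩
    by_cases hxb : x ∈ Set.range b
    · obtain ⟨i, rfl⟩ := hxb
      refine .inl ⟨i, .trans (Set.ext fun y => and_congr_right fun _ => ?_) (hpair i)⟩
      exact ⟨(hpath i).trans, (hpath i).symm.trans⟩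
    · exact .inr ⟨x, hx, hxa, hxb, hsingle hx hxa hxb⟩
  · rintro _ (⟨i, rfl⟩ | ⟨x, hx, hxa, hxb, rfl⟩)
    exacts [⟨a i, (ha i).1, (hpair i).symm⟩, ⟨x, hx, (hsingle hx hxa hxb).symm⟩]

theorem exists_perm_mem_groveSet (hai : Function.Injective a) (hbi : Function.Injective b)
    (ha : ∀ i, a i ∈ bd \ Set.range b) (hb : ∀ i, b i ∈ bd \ Set.range a)
    (hSa : IsRootedForest G S (bd \ Set.range a)) (hSb : IsRootedForest G S (bd \ Set.range b)) :
    ∃ σ : Equiv.Perm (Fin k), S ∈ groveSet G bd a (b ∘ σ) := by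
  have hpartner (i : Fin k) : ∃ j, (spanning G S).Reachable (a i) (b j) := by
    obtain ⟨x, hx, hr⟩ := hSa.exists_root (a i)
    obtain ⟨j, rfl⟩ : x ∈ Set.range b := by
      by_contra hxb
      exact hx.2 ⟨i, hSb.root_unique _ (ha i) _ ⟨hx.1, hxb⟩ hr⟩
    exact ⟨j, hr⟩
  choose τ hτ using hpartner
  have hτ_inj : Function.Injective τ := fun i j hij =>
    hai (hSb.root_unique _ (ha i) _ (ha j) ((hτ i).trans (hij ▸ (hτ j).symm)))
  let σ : Equiv.Perm (Fin k) := .ofBijective τ (Finite.injective_iff_bijective.1 hτ_inj)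
  have hrange : Set.range (b ∘ σ) = Set.range b := σ.surjective.range_comp b
  exact ⟨σ, mem_groveSet_of_isRootedForest hai (hbi.comp σ.injective) (hrange ▸ ha)
    (fun i => hb (σ i)) hSa (hrange ▸ hSb) hτ⟩

theorem perm_unique_of_mem_groveSet (hb : ∀ i, b i ∈ bd \ Set.range a)
    {σ τ : Equiv.Perm (Fin k)} (hσ : S ∈ groveSet G bd a (b ∘ σ))
    (hτ : S ∈ groveSet G bd a (b ∘ τ)) : σ = τ := by
  have hSa : IsRootedForest G S (bd \ Set.range a) :=
    isRootedForest_of_mem_groveSet (fun i => hb (σ i)) hσ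
  have hbi : Function.Injective b := Function.Injective.of_comp_right hσ.2.1 σ.surjective
  refine Equiv.ext fun i => hbi (hSa.root_unique _ (hb _) _ (hb _) ?_)
  exact (reachable_of_mem_groveSet hσ i).symm.trans (reachable_of_mem_groveSet hτ i)

theorem IsGrove.finite_compl (hS : IsGrove G bd S) : bdᶜ.Finite := by
  by_contra hinf
  obtain ⟨W, hW, hcard⟩ := Set.Infinite.exists_subset_card_eq hinf (S.card + 1)
  have hle : Fintype.card W ≤ S.card :=
    card_le_card_of_exists_root (row := Subtype.val) Subtype.val_injective fun v => by
      obtain ⟨x, hx, hvx⟩ := hS.meets_boundary v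
      rw [Subtype.range_coe]
      exact ⟨x, fun hxW => hW hxW hx, hvx⟩
  rw [Fintype.card_coe, hcard] at hle
  omega

end Groves

section Minors

open Matrix

variable {α β : Type*} {G : Graph α β} {bd : Set V(G)} {S : Finset β} {k : ℕ}
  {a b : Fin k → V(G)}

/-- The labels of the rows or columns of the minors in the all-minors matrix-tree theorem: every
interior vertex, and the boundary vertices `a i`. -/
abbrev minorIndex (bd : Set V(G)) (a : Fin k → V(G)) : ↥bdᶜ ⊕ Fin k → V(G) :=
  Sum.elim Subtype.val a

theorem minorIndex_injective (hai : Function.Injective a) (ha : ∀ i, a i ∈ bd) :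
    Function.Injective (minorIndex bd a) :=
  Subtype.val_injective.sumElim hai fun v i h => v.2 (h ▸ ha i)

theorem compl_range_minorIndex (bd : Set V(G)) (a : Fin k → V(G)) :
    (Set.range (minorIndex bd a))ᶜ = bd \ Set.range a := by
  rw [Set.Sum.elim_range, Subtype.range_coe, Set.compl_union, compl_compl, Set.sdiff_eq]

theorem det_incMatrix_minorIndex_comp_perm [Fintype ↥bdᶜ] [DecidableEq ↥bdᶜ]
    (σ : Equiv.Perm (Fin k)) (col : ↥bdᶜ ⊕ Fin k → β) :
    (incMatrix G (minorIndex bd (b ∘ σ)) col).det =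
      Equiv.Perm.sign σ * (incMatrix G (minorIndex bd b) col).det := by
  have hperm := det_permute (Equiv.sumCongr (Equiv.refl _) σ) (incMatrix G (minorIndex bd b) col)
  rw [Equiv.Perm.sign_sumCongr, Equiv.Perm.sign_refl, one_mul, Int.cast_id] at hperm
  rw [← hperm]
  congr 1
  ext (i | i) j <;> rfl

theorem det_incMatrix_mul_det_incMatrix_of_mem_groveSet [Fintype ↥bdᶜ] [DecidableEq ↥bdᶜ]
    (ha : ∀ i, a i ∈ bd \ Set.range b) (hb : ∀ i, b i ∈ bd \ Set.range a)
    (hS : S ∈ groveSet G bd a b) (col : ↥bdᶜ ⊕ Fin k ≃ S) :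
    (incMatrix G (minorIndex bd a) (Subtype.val ∘ col)).det *
      (incMatrix G (minorIndex bd b) (Subtype.val ∘ col)).det = (-1) ^ k := by
  have hSa := isRootedForest_of_mem_groveSet hb hS
  have hSb := isRootedForest_of_mem_groveSet ha (groveSet_comm G bd a b ▸ hS)
  have hswap : (incMatrix G (minorIndex bd b) (Subtype.val ∘ col)).det =
      (-1) ^ k * (incMatrix G (minorIndex bd a) (Subtype.val ∘ col)).det := by
    have hboundary {v : V(G)} (hv : v ∈ bd) : v ∉ Set.range (Subtype.val : ↥bdᶜ → V(G)) := by
      rwa [Subtype.range_coe, Set.notMem_compl_iff]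
    rw [← congrArg ((-1 : ℤ) ^ ·) (Fintype.card_fin k)]
    refine det_incMatrix_sumElim_eq Subtype.val_injective (fun i => hboundary (ha i).1)
      (fun i => hboundary (hb i).1) (fun i h => (ha i).2 ⟨i, h.symm⟩)
      (reachable_of_mem_groveSet hS) (fun i v hv => ?_) fun j => (col j).2
    by_cases hvbd : v ∈ bd
    · exact .inr (eq_or_eq_of_reachable ha hb hSa hSb (reachable_of_mem_groveSet hS i) hvbd hv)
    · exact .inl ⟨⟨v, hvbd⟩, rfl⟩
  rw [hswap, mul_left_comm, det_incMatrix_mul_self (minorIndex_injective hS.1 fun i => (ha i).1)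
    (compl_range_minorIndex bd a ▸ hSa), mul_one]

open Classical in
theorem det_incMatrix_mul_det_incMatrix [Fintype ↥bdᶜ] [DecidableEq ↥bdᶜ]
    (hai : Function.Injective a) (hbi : Function.Injective b)
    (ha : ∀ i, a i ∈ bd \ Set.range b) (hb : ∀ i, b i ∈ bd \ Set.range a)
    (hSE : (S : Set β) ⊆ E(G)) (col : ↥bdᶜ ⊕ Fin k ≃ S) :
    (incMatrix G (minorIndex bd a) (Subtype.val ∘ col)).det *
      (incMatrix G (minorIndex bd b) (Subtype.val ∘ col)).det =
      (-1) ^ k * ∑ σ : Equiv.Perm (Fin k),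
        if S ∈ groveSet G bd a (b ∘ σ) then (Equiv.Perm.sign σ : ℤ) else 0 := by
  have hrange (σ : Equiv.Perm (Fin k)) : Set.range (b ∘ σ) = Set.range b :=
    σ.surjective.range_comp b
  by_cases hrooted : IsRootedForest G S (bd \ Set.range a) ∧ IsRootedForest G S (bd \ Set.range b)
  · obtain ⟨σ, hσ⟩ := exists_perm_mem_groveSet hai hbi ha hb hrooted.1 hrooted.2
    have hdet := det_incMatrix_mul_det_incMatrix_of_mem_groveSet (b := b ∘ σ) (hrange σ ▸ ha)
      (fun i => hb (σ i)) hσ col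
    rw [det_incMatrix_minorIndex_comp_perm] at hdet
    rw [Fintype.sum_eq_single σ fun τ hne =>
      if_neg fun hτ => hne (perm_unique_of_mem_groveSet hb hτ hσ), if_pos hσ, ← hdet]
    have hsign : (Equiv.Perm.sign σ : ℤ) * Equiv.Perm.sign σ = 1 := by
      rw [← Units.val_mul, Int.units_mul_self, Units.val_one]
    linear_combination (-(incMatrix G (minorIndex bd a) (Subtype.val ∘ col)).det *
      (incMatrix G (minorIndex bd b) (Subtype.val ∘ col)).det) * hsign
  · have hnot (σ : Equiv.Perm (Fin k)) : S ∉ groveSet G bd a (b ∘ σ) := fun hσ => by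
      have hSb := isRootedForest_of_mem_groveSet (hrange σ ▸ ha) (groveSet_comm G bd a _ ▸ hσ)
      exact hrooted ⟨isRootedForest_of_mem_groveSet (fun i => hb (σ i)) hσ, hrange σ ▸ hSb⟩
    simp only [hnot, if_false, Finset.sum_const_zero, mul_zero, mul_eq_zero]
    refine (not_and_or.1 hrooted).imp (fun h => ?_) fun h => ?_
    · exact det_incMatrix_eq_zero (minorIndex_injective hai fun i => (ha i).1) hSE
        (compl_range_minorIndex bd a ▸ h) col
    · exact det_incMatrix_eq_zero (minorIndex_injective hbi fun i => (hb i).1) hSE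
        (compl_range_minorIndex bd b ▸ h) col

end Minors

section Laplacian

open Matrix

variable {α β R : Type*} [CommRing R] {G : Graph α β} {bd : Set V(G)} {S : Finset β} {k : ℕ}
  {a b : Fin k → V(G)}

/-- The weighted Laplacian matrix of the spanning subgraph of `G` with edge set `F`, as the product
of the incidence matrix, the diagonal matrix of weights and the transposed incidence matrix. -/
noncomputable def laplacian (G : Graph α β) (F : Finset β) (wt : β → R) : Matrix V(G) V(G) R :=
  of fun u v => ∑ e ∈ F, (incidence G e u : R) * (wt e * incidence G e v)

theorem det_laplacian_submatrix {m : Type*} [Fintype m] [DecidableEq m] (wt : β → R)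
    (r c : m → V(G)) (col : m ≃ S) :
    ((laplacian G S wt).submatrix r c).det =
      weight wt S * (((incMatrix G r (Subtype.val ∘ col)).det *
        (incMatrix G c (Subtype.val ∘ col)).det : ℤ) : R) := by
  have hleft : (of fun i e => (incidence G e (r i) : R)).submatrix id (Subtype.val ∘ col) =
      (incMatrix G r (Subtype.val ∘ col)).map fun x => (x : R) := rfl
  have hright : (of fun e j => wt e * (incidence G e (c j) : R)).submatrix (Subtype.val ∘ col) id =
      of fun i j => wt (col i) * ((incMatrix G c (Subtype.val ∘ col)).map fun x => (x : R))ᵀ i j :=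
    rfl
  have hweight : weight wt S = ∏ i, wt (col i) := by
    rw [weight, ← Finset.prod_coe_sort, ← col.prod_comp]
  have hdet := det_sum_mul_eq_det_mul_det (of fun i e => (incidence G e (r i) : R))
    (of fun e j => wt e * (incidence G e (c j) : R)) col
  rw [hleft, hright, det_mul_column, det_transpose, ← Int.cast_det, ← Int.cast_det] at hdet
  rw [hweight, Int.cast_mul, mul_left_comm]
  exact hdet

theorem finsum_groveSet [Fintype ↥bdᶜ] {F : Finset β} (hF : (F : Set β) = E(G)) (ha : ∀ i, a i ∈ bd)
    (hb : ∀ i, b i ∈ bd \ Set.range a) (wt : β → R)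
    [DecidablePred (· ∈ groveSet G bd a b)] :
    ∑ᶠ S ∈ groveSet G bd a b, weight wt S =
      ∑ S ∈ F.powersetCard (Fintype.card (↥bdᶜ ⊕ Fin k)),
        if S ∈ groveSet G bd a b then weight wt S else 0 := by
  rw [← Finset.sum_filter, ← finsum_mem_coe_finset]
  congr! 3 with S
  simp only [Finset.coe_filter, Finset.mem_powersetCard, Set.mem_ofPred_eq, iff_and_self]
  intro hS
  have hforest := isRootedForest_of_mem_groveSet hb hS
  rw [← compl_range_minorIndex] at hforest
  refine ⟨?_, hforest.card_eq (minorIndex_injective hS.1 ha)⟩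
  rw [← Finset.coe_subset, hF]
  exact hforest.subset

open Classical in
theorem det_laplacian_minorIndex_of_card_eq [Fintype ↥bdᶜ] [DecidableEq ↥bdᶜ]
    (hai : Function.Injective a) (hbi : Function.Injective b)
    (ha : ∀ i, a i ∈ bd \ Set.range b) (hb : ∀ i, b i ∈ bd \ Set.range a)
    (hSE : (S : Set β) ⊆ E(G)) (hcard : S.card = Fintype.card (↥bdᶜ ⊕ Fin k)) (wt : β → R) :
    ((laplacian G S wt).submatrix (minorIndex bd a) (minorIndex bd b)).det =
      (-1) ^ k * ∑ σ : Equiv.Perm (Fin k), ((Equiv.Perm.sign σ : ℤ) : R) *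
        if S ∈ groveSet G bd a (b ∘ σ) then weight wt S else 0 := by
  have col : ↥bdᶜ ⊕ Fin k ≃ S := Fintype.equivOfCardEq (by rw [Fintype.card_coe, hcard])
  rw [det_laplacian_submatrix wt _ _ col, det_incMatrix_mul_det_incMatrix hai hbi ha hb hSE col]
  push_cast
  rw [mul_left_comm, Finset.mul_sum]
  simp only [mul_ite, ite_mul, mul_zero, zero_mul, mul_comm (weight wt S)]

/-- The **all-minors matrix-tree theorem**, for the minors that contain every interior row and
column. -/
theorem det_laplacian_minorIndex [Fintype ↥bdᶜ] [DecidableEq ↥bdᶜ] {F : Finset β}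
    (hF : (F : Set β) = E(G)) (ha : ∀ i, a i ∈ bd \ Set.range b)
    (hb : ∀ i, b i ∈ bd \ Set.range a) (wt : β → R) :
    ((laplacian G F wt).submatrix (minorIndex bd a) (minorIndex bd b)).det =
      (-1) ^ k * ∑ σ : Equiv.Perm (Fin k),
        ((Equiv.Perm.sign σ : ℤ) : R) * ∑ᶠ S ∈ groveSet G bd a (b ∘ σ), weight wt S := by
  classical
  by_cases hinj : Function.Injective a ∧ Function.Injective b
  · have hcauchyBinet := det_sum_mul_eq_sum_powersetCard
      (of fun i e => (incidence G e (minorIndex bd a i) : R))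
      (of fun e j => wt e * (incidence G e (minorIndex bd b j) : R)) F
    refine hcauchyBinet.trans ?_
    simp only [fun σ : Equiv.Perm (Fin k) => finsum_groveSet (b := b ∘ σ) hF (fun i => (ha i).1)
      (fun i => hb (σ i)) wt, Finset.mul_sum]
    rw [Finset.sum_comm]
    refine Finset.sum_congr rfl fun S hS => ?_
    obtain ⟨hSF, hcard⟩ := Finset.mem_powersetCard.1 hS
    rw [← Finset.mul_sum]
    exact det_laplacian_minorIndex_of_card_eq hinj.1 hinj.2 ha hb
      (hF ▸ Finset.coe_subset.2 hSF) hcard wt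
  · have hempty (σ : Equiv.Perm (Fin k)) : groveSet G bd a (b ∘ σ) = ∅ :=
      Set.eq_empty_of_forall_notMem fun S hS =>
        hinj ⟨hS.1, Function.Injective.of_comp_right hS.2.1 σ.surjective⟩
    simp only [hempty, finsum_mem_empty, mul_zero, Finset.sum_const_zero]
    exact det_submatrix_eq_zero_of_not_injective _ fun h =>
      hinj (h.imp (·.comp Sum.inr_injective) (·.comp Sum.inr_injective))

theorem det_laplacian_interior [Fintype ↥bdᶜ] [DecidableEq ↥bdᶜ] {F : Finset β}
    (hF : (F : Set β) = E(G)) (wt : β → R) :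
    ((laplacian G F wt).submatrix (Subtype.val : ↥bdᶜ → V(G)) Subtype.val).det = Z G bd wt := by
  have hminor := det_laplacian_minorIndex (bd := bd) hF (a := ![]) (b := ![]) nofun nofun wt
  rw [← det_submatrix_equiv_self (Equiv.sumEmpty ↥bdᶜ (Fin 0)).symm] at hminor
  rw [pow_zero, one_mul, Fintype.sum_unique, Subsingleton.elim default 1, Equiv.Perm.sign_one,
    Units.val_one, Int.cast_one, one_mul, ← treeSet_eq_groveSet] at hminor
  exact hminor

theorem signedGroveSum_eq_det_laplacian [Fintype ↥bdᶜ] [DecidableEq ↥bdᶜ] {F : Finset β}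
    (hF : (F : Set β) = E(G)) (ha : ∀ i, a i ∈ bd) (hb : ∀ i, b i ∈ bd)
    (hab : ∀ i j, a i ≠ b j) (wt : β → R) :
    signedGroveSum G bd wt a b = (-1) ^ k * (Ring.inverse (Z G bd wt) *
      ((laplacian G F wt).submatrix (minorIndex bd a) (minorIndex bd b)).det) := by
  have ha' (i : Fin k) : a i ∈ bd \ Set.range b := ⟨ha i, fun ⟨j, h⟩ => hab i j h.symm⟩
  have hb' (j : Fin k) : b j ∈ bd \ Set.range a := ⟨hb j, fun ⟨i, h⟩ => hab i j h⟩
  have hsign : (-1 : R) ^ k * (-1) ^ k = 1 := by rw [← mul_pow, neg_one_mul, neg_neg, one_pow]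
  simp only [signedGroveSum, groveSum, mul_left_comm _ (Ring.inverse (Z G bd wt)),
    ← Finset.mul_sum]
  rw [det_laplacian_minorIndex hF ha' hb', ← mul_assoc ((-1 : R) ^ k), hsign, one_mul]

theorem finite_compl_of_Z_ne_zero {wt : β → R} (hZ : Z G bd wt ≠ 0) : bdᶜ.Finite := by
  obtain ⟨S, hS⟩ := exists_ne_zero_of_finsum_mem_ne_zero hZ
  exact hS.1.1.finite_compl

end Laplacian

end Grove

theorem mainTheorem3_general {α β R : Type*} [CommRing R] (G : Graph α β) (hE : E(G).Finite)
    (bd : Set V(G)) (wt : β → R) (hZ : IsUnit (Grove.Z G bd wt))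
    (k : ℕ) (a b : Fin k → V(G)) (ha : ∀ i, a i ∈ bd) (hb : ∀ i, b i ∈ bd)
    (hab : ∀ i j, a i ≠ b j) :
    Grove.signedGroveSum G bd wt a b =
      Matrix.det (Matrix.of fun i j : Fin k => Grove.signedGroveSum G bd wt ![a i] ![b j]) := by
  classical
  cases subsingleton_or_nontrivial R
  · exact Subsingleton.elim _ _
  have hinterior : bdᶜ.Finite := Grove.finite_compl_of_Z_ne_zero hZ.ne_zero
  have := hinterior.fintype
  obtain ⟨F, hF⟩ := hE.exists_finset_coe
  have hinteriorMinor := Grove.det_laplacian_interior (bd := bd) hF wt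
  have hsylvester := Grove.det_submatrix_sumElim (Grove.laplacian G F wt) Subtype.val
    (hinteriorMinor ▸ hZ) a b
  rw [Grove.signedGroveSum_eq_det_laplacian hF ha hb hab, hsylvester, hinteriorMinor,
    Ring.inverse_mul_cancel_left _ _ hZ, ← congrArg ((-1 : R) ^ ·) (Fintype.card_fin k),
    ← Matrix.det_neg]
  congr 1
  ext i j
  rw [Matrix.of_apply, Grove.signedGroveSum_eq_det_laplacian hF (by simpa using ha i)
    (by simpa using hb j) (by simpa using hab i j), pow_one, neg_one_mul]
  rfl

theorem mainTheorem3 {α β R : Type*} [CommRing R] (G : Graph α β)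
    (hV : V(G).Finite) (hE : E(G).Finite)
    (bd : Set V(G)) (hbd : Grove.ComponentsMeetBoundary G bd)
    (wt : β → R) (hZ : IsUnit (Grove.Z G bd wt))
    (k : ℕ) (a b : Fin k → V(G)) (ha : ∀ i, a i ∈ bd) (hb : ∀ i, b i ∈ bd)
    (hab : ∀ i j, a i ≠ b j) :
    Grove.signedGroveSum G bd wt a b =
      Matrix.det (Matrix.of fun i j : Fin k => Grove.signedGroveSum G bd wt ![a i] ![b j]) :=
  mainTheorem3_general G hE bd wt hZ k a b ha hb hab
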